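/- Let $n\ge 0$ and let $A,B\in\mathbb{C}^{n\times n}$, where $A$ has no eigenvalues on the closed negative real axis $\mathbb{R}_0^-=(-\infty,0]$. Then $A$ has a unique principal logarithm $\log(A)$, i.e. the equation $e^X=A$ has exactly one solution $X\in\mathbb{C}^{n\times n}$ all of whose eigenvalues $z$ satisfy $-\pi<\operatorname{Im} z<\pi$. Write $$A^B:=e^{\log(A)B},\qquad {}^{B}\!A:=e^{B\log(A)},\qquad f(A,B):=A^B,$$ and, for $\alpha\in\mathbb{R}$, let $A^\alpha$ denote the primary matrix function of $A$ with stem function the principal branch of $z\mapsto z^\alpha$ (that is, $A^\alpha=p(A)$ for any polynomial $p$ with $p^{(k)}(\lambda)=\frac{d^k}{dz^k}z^\alpha\big|_{z=\lambda}$ for each eigenvalue $\lambda$ of $A$ and each $k\geq 0$ smaller than the multiplicity of $\lambda$ in the minimal polynomial of $A$). The following hold, and the bases $I$ in (i), $A^B$ in (iii), $A^*$ in (v) and $SAS^{-1}$ in (vi) also have no eigenvalues on $\mathbb{R}_0^-$. (i) $A^0=I$ and $I^B=I$. (ii) $A^{\alpha I}=A^\alpha$ for every $\alpha\in\mathbb{R}$.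 In particular, $A^{\frac12 I}$ is the principal square root of $A$ (the unique $X$ with $X^2=A$ whose eigenvalues all have positive real part), and $A$ is invertible with $A^{-I}=A^{-1}$. (iii) If every eigenvalue $\lambda$ of $\log(A)B$ satisfies $-\pi<\operatorname{Im}\lambda<\pi$, then $A^{(BC)}=(A^B)^C$ for every $C\in\mathbb{C}^{n\times n}$. (iv) $A^{-B}A^B=A^BA^{-B}=I$, and therefore $(A^B)^{-1}=A^{-B}$. (v) $(A^B)^*={}^{B^*}\!(A^*)$, where $X^*$ is the conjugate transpose of $X$. (vi) If $S\in\mathbb{C}^{n\times n}$ is invertible, then $f(SAS^{-1},SBS^{-1})=S\,f(A,B)\,S^{-1}$. -/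

import Mathlib

noncomputable section

namespace MatrixPower

variable {n : ℕ}

/-- `A` has no eigenvalue on the closed negative real axis (`0` included). -/
def NoNonposEigenvalue (A : Matrix (Fin n) (Fin n) ℂ) : Prop :=
  ∀ r : ℝ, r ≤ 0 → (r : ℂ) ∉ spectrum ℂ A

/-- All eigenvalues of `X` lie in the open strip `-π < Im z < π`. -/
def SpectrumInStrip (X : Matrix (Fin n) (Fin n) ℂ) : Prop :=
  ∀ z ∈ spectrum ℂ X, -Real.pi < z.im ∧ z.im < Real.pi

/-- `X` is a principal logarithm of `A`: it solves `e ^ X = A` and its eigenvalues lie in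
the open strip `-π < Im z < π`. -/
def IsPrincipalLog (A X : Matrix (Fin n) (Fin n) ℂ) : Prop :=
  NormedSpace.exp X = A ∧ SpectrumInStrip X

open Classical in
/-- The principal logarithm `log A` (with value `0` if `A` has no principal logarithm). -/
def principalLog (A : Matrix (Fin n) (Fin n) ℂ) : Matrix (Fin n) (Fin n) ℂ :=
  if h : ∃ X, IsPrincipalLog A X then h.choose else 0

/-- The matrix-matrix exponentiation `A ^ B = e ^ (log(A) B)`. -/
def matPow (A B : Matrix (Fin n) (Fin n) ℂ) : Matrix (Fin n) (Fin n) ℂ :=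
  NormedSpace.exp (principalLog A * B)

/-- The other matrix-matrix exponentiation, `e ^ (B log(A))`, with the exponent written as a
left superscript. -/
def leftMatPow (A B : Matrix (Fin n) (Fin n) ℂ) : Matrix (Fin n) (Fin n) ℂ :=
  NormedSpace.exp (B * principalLog A)

/-- The polynomial `p` takes the values of `f` on the spectrum of `A`, in the sense of Hermite
interpolation: the derivatives of `p` and `f` agree at each eigenvalue `z` of `A` for all orders
below the multiplicity of `z` in the minimal polynomial, i.e. below the size of the largest
Jordan block of `A` for `z`. -/
def Interpolates (f : ℂ → ℂ) (A : Matrix (Fin n) (Fin n) ℂ) (p : Polynomial ℂ) : Prop :=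
  ∀ z ∈ spectrum ℂ A, ∀ k < (minpoly ℂ A).rootMultiplicity z,
    (Polynomial.derivative^[k] p).eval z = iteratedDeriv k f z

open Classical in
/-- The primary matrix function `f(A)` with scalar stem function `f`: it is `p(A)` for any
polynomial `p` that takes the values of `f` on the spectrum of `A` (any two such `p` differ by a
multiple of the minimal polynomial of `A`). -/
def primaryFunction (f : ℂ → ℂ) (A : Matrix (Fin n) (Fin n) ℂ) : Matrix (Fin n) (Fin n) ℂ :=
  if h : ∃ p : Polynomial ℂ, Interpolates f A p then Polynomial.aeval A h.choose else 0

/-- The real power `A ^ α` of a matrix: the primary matrix function with stem function the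
principal branch of `z ^ α`. -/
def realPow (A : Matrix (Fin n) (Fin n) ℂ) (α : ℝ) : Matrix (Fin n) (Fin n) ℂ :=
  primaryFunction (fun z : ℂ => z ^ (α : ℂ)) A

/-- `X` is a principal square root of `A`: a square root with all its eigenvalues in the open
right half-plane. -/
def IsPrincipalSqrt (A X : Matrix (Fin n) (Fin n) ℂ) : Prop :=
  X * X = A ∧ ∀ z ∈ spectrum ℂ X, 0 < z.re

end MatrixPower

end

/-! Everything reduces to polynomials in one matrix. Agreement of two functions to order `m` at an
eigenvalue is written as a difference that is `O((z - a) ^ m)`. This passes through compositions,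
and for polynomials it means divisibility by `(X - a) ^ m`.

The bridge to matrices is `exp_aeval_eq_aeval`. Multiplying by a primary cofactor of the minimal
polynomial makes `q(A) - q(a)` nilpotent, so its exponential series terminates and only Taylor
coefficients matter; `eq_zero_of_mul_aeval_cofactor` glues the eigenvalues together.

Interpolating `log` by `l` then gives existence and uniqueness of the logarithm at once, as `l(A)`
(`isPrincipalLog_iff_eq_aeval`). Given uniqueness, (i), (iii), (v) and (vi) only require exhibiting
a logarithm with spectrum in the strip, and (ii) compares `exp (α log A)` with an interpolant of `z
^ α`. -/

noncomputable section

namespace MatrixPower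

open Filter Topology Asymptotics Polynomial

variable {n : ℕ}

/-! ### Orders of vanishing and Hermite interpolation -/

/-- A function `(z - a) ^ k * h z` that is `O((z - a) ^ m)` with `k < m` has `h a = 0`. -/
lemma eq_zero_of_pow_mul_isBigO {a : ℂ} {h : ℂ → ℂ} {k m : ℕ} (hkm : k < m)
    (hc : ContinuousAt h a)
    (hO : (fun z => (z - a) ^ k * h z) =O[𝓝 a] fun z => (z - a) ^ m) : h a = 0 := by
  have h1 : h =O[𝓝[≠] a] fun z => (z - a) ^ (m - k) := by
    have h2 := (isBigO_refl (fun z : ℂ => ((z - a) ^ k)⁻¹) (𝓝[≠] a)).mul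
      (hO.mono nhdsWithin_le_nhds)
    refine h2.congr' ?_ ?_
    · filter_upwards [self_mem_nhdsWithin] with z hz
      have : z - a ≠ 0 := sub_ne_zero.2 hz
      field_simp
    · filter_upwards [self_mem_nhdsWithin] with z hz
      have : z - a ≠ 0 := sub_ne_zero.2 hz
      rw [pow_sub₀ _ this hkm.le, mul_comm]
  have h3 : Tendsto (fun z : ℂ => (z - a) ^ (m - k)) (𝓝[≠] a) (𝓝 0) := by
    have h4 : ContinuousAt (fun z : ℂ => (z - a) ^ (m - k)) a := by fun_prop
    have h5 := h4.tendsto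
    simp only [sub_self] at h5
    rw [zero_pow (by omega)] at h5
    exact h5.mono_left nhdsWithin_le_nhds
  exact tendsto_nhds_unique (hc.tendsto.mono_left nhdsWithin_le_nhds) (h1.trans_tendsto h3)

/-- An analytic function is `O((z - a) ^ m)` iff its first `m` derivatives vanish at `a`. -/
lemma isBigO_pow_iff_iteratedDeriv_eq_zero {f : ℂ → ℂ} {a : ℂ} (hf : AnalyticAt ℂ f a) (m : ℕ) :
    f =O[𝓝 a] (fun z => (z - a) ^ m) ↔ ∀ k < m, iteratedDeriv k f a = 0 := by
  rw [← natCast_le_analyticOrderAt_iff_iteratedDeriv_eq_zero hf]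
  constructor
  · intro hO
    by_contra! hlt
    obtain ⟨k, hk⟩ := ENat.ne_top_iff_exists.1 hlt.ne_top
    rw [← hk] at hlt
    obtain ⟨g, hg, hg0, hfg⟩ := hf.analyticOrderAt_eq_natCast.1 hk.symm
    refine hg0 (eq_zero_of_pow_mul_isBigO (by exact_mod_cast hlt) hg.continuousAt
      (hO.congr' ?_ EventuallyEq.rfl))
    simpa [EventuallyEq] using hfg
  · intro h
    obtain ⟨g, hg, hfg⟩ := (natCast_le_analyticOrderAt hf).1 h
    have h1 : (fun z => (z - a) ^ m * g z) =O[𝓝 a] fun z => (z - a) ^ m * (1 : ℂ) :=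
      (isBigO_refl _ _).mul (hg.continuousAt.isBigO_one ℂ)
    refine h1.congr' ?_ (by simp [EventuallyEq])
    filter_upwards [hfg] with z hz
    simp [hz]

lemma analyticAt_eval (p : ℂ[X]) (a : ℂ) : AnalyticAt ℂ (fun z => p.eval z) a :=
  p.differentiable.analyticAt a

lemma eval_iterate_derivative_eq_iteratedDeriv (p : ℂ[X]) (k : ℕ) (a : ℂ) :
    (derivative^[k] p).eval a = iteratedDeriv k (fun z => p.eval z) a := by
  induction k generalizing p with
  | zero => simp
  | succ k ih =>
    rw [Function.iterate_succ_apply, ih, iteratedDeriv_succ']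
    congr 1
    ext z
    simp

/-- Otherwise, cancelling the exact power of `X - a` in `p` leaves a cofactor that still vanishes at
`a`. -/
lemma pow_dvd_of_isBigO {p : ℂ[X]} {a : ℂ} {m : ℕ}
    (hO : (fun z => p.eval z) =O[𝓝 a] fun z => (z - a) ^ m) : (X - C a) ^ m ∣ p := by
  by_cases hp : p = 0
  · simp [hp]
  rw [← le_rootMultiplicity_iff hp]
  by_contra! hlt
  obtain ⟨q, hq, hndvd⟩ := exists_eq_pow_rootMultiplicity_mul_and_not_dvd p hp a
  rw [dvd_iff_isRoot] at hndvd
  refine hndvd (eq_zero_of_pow_mul_isBigO (h := fun z => q.eval z) hlt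
    q.continuous.continuousAt ?_)
  convert hO using 2 with z
  conv_rhs => rw [hq]
  simp

lemma isBigO_of_pow_dvd {p : ℂ[X]} {a : ℂ} {m : ℕ} (h : (X - C a) ^ m ∣ p) :
    (fun z => p.eval z) =O[𝓝 a] fun z => (z - a) ^ m := by
  obtain ⟨q, rfl⟩ := h
  have h1 : (fun z => (z - a) ^ m * q.eval z) =O[𝓝 a] fun z => (z - a) ^ m * (1 : ℂ) :=
    (isBigO_refl _ _).mul (q.continuous.continuousAt.isBigO_one ℂ)
  simpa using h1

lemma isBigO_pow_of_le {a : ℂ} {k m : ℕ} (h : k ≤ m) :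
    (fun z : ℂ => (z - a) ^ m) =O[𝓝 a] fun z => (z - a) ^ k := by
  simpa using isBigO_of_pow_dvd (p := (X - C a) ^ m) (pow_dvd_pow (X - C a) h)

/-- Functions that agree to positive order at `a` have the same value at `a`. -/
lemma eq_of_isBigO_sub {f g : ℂ → ℂ} {a : ℂ} {m : ℕ} (hm : m ≠ 0)
    (h : (fun z => f z - g z) =O[𝓝 a] fun z => (z - a) ^ m) : f a = g a := by
  have h1 := h.eq_zero_imp.self_of_nhds
  simpa [hm, sub_eq_zero] using h1

/-- An analytic function is locally Lipschitz. -/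
lemma isBigO_comp_sub_comp {F u v : ℂ → ℂ} {a b : ℂ} (hF : AnalyticAt ℂ F b)
    (hu : Tendsto u (𝓝 a) (𝓝 b)) (hv : Tendsto v (𝓝 a) (𝓝 b)) :
    (fun z => F (u z) - F (v z)) =O[𝓝 a] fun z => u z - v z := by
  have h := hF.hasStrictFDerivAt.isBigO_sub
  exact h.comp_tendsto (k := fun z => (u z, v z)) (hu.prodMk_nhds hv)

lemma exists_taylor_isBigO {f : ℂ → ℂ} {a : ℂ} (hf : AnalyticAt ℂ f a) (m : ℕ) :
    ∃ p : ℂ[X], (fun z => p.eval z - f z) =O[𝓝 a] fun z => (z - a) ^ m := by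
  obtain ⟨c, hc⟩ := hf
  refine ⟨∑ k ∈ Finset.range m, C (c.coeff k) * (X - C a) ^ k, ?_⟩
  have h1 := (hc.isBigO_sub_partialSum_pow m).comp_tendsto
    (show Tendsto (fun z : ℂ => z - a) (𝓝 a) (𝓝 0) by
      have : ContinuousAt (fun z : ℂ => z - a) a := by fun_prop
      simpa using this.tendsto)
  rw [← isBigO_norm_right]
  refine (h1.neg_left).congr (fun z => ?_) (fun z => by simp)
  simp [FormalMultilinearSeries.partialSum, eval_finsetSum, mul_comm]

/-- Hermite interpolation of a locally analytic function at finitely many points. -/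
lemma exists_polynomial_isBigO_sub {s : Set ℂ} (hs : s.Finite) {f : ℂ → ℂ}
    (hf : ∀ a ∈ s, AnalyticAt ℂ f a) (m : ℕ) :
    ∃ p : ℂ[X], ∀ a ∈ s, (fun z => p.eval z - f z) =O[𝓝 a] fun z => (z - a) ^ m := by
  have := hs.to_subtype
  choose t ht using fun a : s => exists_taylor_isBigO (hf a a.2) m
  obtain ⟨p, hp⟩ := Ideal.exists_forall_sub_mem_ideal
    (I := fun a : s => Ideal.span {(X - C (a : ℂ)) ^ m}) (fun a b hab => by
      rw [Function.onFun, Ideal.isCoprime_span_singleton_iff]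
      exact (pairwise_coprime_X_sub_C Subtype.val_injective hab).pow) t
  refine ⟨p, fun a ha => ?_⟩
  have h1 := isBigO_of_pow_dvd (Ideal.mem_span_singleton.1 (hp ⟨a, ha⟩))
  refine (h1.add (ht ⟨a, ha⟩)).congr_left fun z => ?_
  simp

/-! ### Polynomials in a matrix and its exponential -/

lemma mem_spectrum_of_isRoot_minpoly {A : Matrix (Fin n) (Fin n) ℂ} {a : ℂ}
    (h : (minpoly ℂ A).IsRoot a) : a ∈ spectrum ℂ A :=
  Matrix.mem_spectrum_iff_isRoot_charpoly.2 (h.dvd A.minpoly_dvd_charpoly)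

lemma minpoly_ne_zero (A : Matrix (Fin n) (Fin n) ℂ) : minpoly ℂ A ≠ 0 :=
  minpoly.ne_zero A.isIntegral

/-- A matrix vanishes if it is annihilated by each primary cofactor of the minimal polynomial
of `A`, evaluated at `A`. -/
lemma eq_zero_of_mul_aeval_cofactor {A D : Matrix (Fin n) (Fin n) ℂ}
    (h : ∀ a ∈ spectrum ℂ A, ∀ M : ℂ[X],
      minpoly ℂ A = (X - C a) ^ (minpoly ℂ A).rootMultiplicity a * M → D * aeval A M = 0) :
    D = 0 := by
  let I : Ideal ℂ[X] :=
    { carrier := {p | D * aeval A p = 0}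
      add_mem' := fun {p q} hp hq => by
        simp only [Set.mem_ofPred_eq] at hp hq ⊢
        rw [map_add, mul_add, hp, hq, add_zero]
      zero_mem' := by simp
      smul_mem' := fun c p hp => by
        simp only [Set.mem_ofPred_eq] at hp ⊢
        rw [smul_eq_mul, mul_comm, map_mul, ← mul_assoc, hp, zero_mul] }
  have hI : ∀ p, p ∈ I ↔ D * aeval A p = 0 := fun p => Iff.rfl
  obtain ⟨d, hd⟩ := (IsPrincipalIdealRing.principal I).principal
  have hmem : ∀ p, p ∈ I ↔ d ∣ p := fun p => by
    rw [hd]; exact Ideal.mem_span_singleton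
  have hdm : d ∣ minpoly ℂ A := (hmem _).1 ((hI _).2 (by simp))
  have hd0 : d ≠ 0 := ne_zero_of_dvd_ne_zero (minpoly_ne_zero A) hdm
  have hunit : IsUnit d := by
    -- A root `a` of the generator `d` is an eigenvalue, since `d` divides the minimal polynomial.
    -- Its cofactor `M` lies in the ideal, so `d` divides `M`, although `X - a` does not.
    by_contra hu
    obtain ⟨a, ha⟩ := IsAlgClosed.exists_root d
      (fun h0 => hu (isUnit_iff_degree_eq_zero.2 h0))
    obtain ⟨M, hM, hndvd⟩ :=
      exists_eq_pow_rootMultiplicity_mul_and_not_dvd _ (minpoly_ne_zero A) a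
    have h1 := (hmem M).1 ((hI M).2
      (h a (mem_spectrum_of_isRoot_minpoly (ha.dvd hdm)) M hM))
    exact hndvd ((dvd_iff_isRoot.2 ha).trans h1)
  have h1 := (hI 1).1 ((hmem 1).2 hunit.dvd)
  simpa using h1

/-- The cofactor `M` cancels `(X - a) ^ m`. -/
lemma aeval_mul_aeval_cofactor_eq_zero {A : Matrix (Fin n) (Fin n) ℂ} {a : ℂ} {m : ℕ}
    {M p : ℂ[X]} (hM : minpoly ℂ A = (X - C a) ^ m * M) (hp : (X - C a) ^ m ∣ p) :
    aeval A p * aeval A M = 0 := by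
  obtain ⟨q, rfl⟩ := hp
  rw [← map_mul, mul_right_comm, ← hM, map_mul, minpoly.aeval, zero_mul]

lemma exp_smul_one_add (c : ℂ) (W : Matrix (Fin n) (Fin n) ℂ) :
    NormedSpace.exp (c • 1 + W) = Complex.exp c • NormedSpace.exp W := by
  have h : NormedSpace.exp (c • (1 : Matrix (Fin n) (Fin n) ℂ)) = Complex.exp c • 1 := by
    rw [Matrix.smul_one_eq_diagonal, Matrix.exp_diagonal, Matrix.smul_one_eq_diagonal]
    congr 1
    ext i
    rw [Pi.coe_exp, Complex.exp_eq_exp_ℂ]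
  rw [Matrix.exp_add_of_commute _ _ ((Commute.one_left W).smul_left c), h, smul_mul_assoc, one_mul]

lemma exp_mul_eq_sum_of_pow_mul_eq_zero {W M : Matrix (Fin n) (Fin n) ℂ} {m : ℕ}
    (h : W ^ m * M = 0) :
    NormedSpace.exp W * M = (∑ k ∈ Finset.range m, ((k.factorial : ℂ)⁻¹) • W ^ k) * M := by
  open scoped Matrix.Norms.Operator in
  have h1 := (NormedSpace.exp_series_hasSum_exp' (𝕂 := ℂ) W).mul_right M
  have h2 := hasSum_sum_of_ne_finset_zero (L := .unconditional ℕ) (s := Finset.range m)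
    (f := fun k : ℕ => ((k.factorial : ℂ)⁻¹ • W ^ k) * M) (fun k hk => by
      rw [Finset.mem_range, not_lt] at hk
      rw [smul_mul_assoc, ← Nat.sub_add_cancel hk, pow_add, mul_assoc, h, mul_zero, smul_zero])
  rw [Finset.sum_mul]
  exact h1.unique h2

/-- If `r` agrees with `exp ∘ q` on the spectrum of `A`, then `exp (q(A)) = r(A)`. -/
theorem exp_aeval_eq_aeval {A : Matrix (Fin n) (Fin n) ℂ} {q r : ℂ[X]}
    (h : ∀ a ∈ spectrum ℂ A, (fun z => r.eval z - Complex.exp (q.eval z)) =O[𝓝 a]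
      fun z => (z - a) ^ (minpoly ℂ A).rootMultiplicity a) :
    NormedSpace.exp (aeval A q) = aeval A r := by
  rw [← sub_eq_zero]
  refine eq_zero_of_mul_aeval_cofactor (A := A) fun a ha M hM => ?_
  set m := (minpoly ℂ A).rootMultiplicity a
  set w : ℂ[X] := q - C (q.eval a) with hw
  have hdvd : (X - C a) ∣ w := X_sub_C_dvd_sub_C_eval
  have hwm : (X - C a) ^ m ∣ w ^ m := pow_dvd_pow_of_dvd hdvd m
  set s : ℂ[X] := ∑ k ∈ Finset.range m, C ((k.factorial : ℂ)⁻¹) * w ^ k with hs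
  have hqa : aeval A q = q.eval a • (1 : Matrix (Fin n) (Fin n) ℂ) + aeval A w := by
    simp [hw, Algebra.algebraMap_eq_smul_one]
  have h1 : NormedSpace.exp (aeval A q) * aeval A M =
      aeval A (C (Complex.exp (q.eval a)) * s) * aeval A M := by
    have h2 := aeval_mul_aeval_cofactor_eq_zero hM hwm
    rw [map_pow] at h2
    rw [hqa, exp_smul_one_add, smul_mul_assoc, exp_mul_eq_sum_of_pow_mul_eq_zero h2, map_mul,
      aeval_C, Algebra.algebraMap_eq_smul_one, smul_mul_assoc, one_mul, smul_mul_assoc, hs,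
      map_sum]
    simp [Algebra.algebraMap_eq_smul_one]
  -- Both sides agree with `exp ∘ q` to order `m` at `a`: the left one by truncating the series of
  -- `exp (w z)`, where `w` vanishes at `a`, and `r` by hypothesis.
  have h3 : (X - C a) ^ m ∣ C (Complex.exp (q.eval a)) * s - r := by
    apply pow_dvd_of_isBigO
    have hw0 : Tendsto (fun z => w.eval z) (𝓝 a) (𝓝 0) := by
      have := w.continuous.continuousAt (x := a).tendsto
      simpa [hw] using this
    have h4 := ((Complex.exp_sub_sum_range_isBigO_pow m).comp_tendsto hw0).const_mul_left
      (-Complex.exp (q.eval a))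
    have h5 := h4.trans ((isBigO_of_pow_dvd hwm).congr_left fun z => by simp)
    refine (h5.sub (h a ha)).congr_left fun z => ?_
    have h6 : Complex.exp (q.eval z) = Complex.exp (q.eval a) * Complex.exp (w.eval z) := by
      rw [← Complex.exp_add]; simp [hw]
    rw [h6]
    simp only [Function.comp_apply, hs, eval_sub, eval_mul, eval_C, eval_finsetSum, eval_pow,
      div_eq_inv_mul]
    ring
  rw [sub_mul, h1, ← sub_mul, ← map_sub]
  exact aeval_mul_aeval_cofactor_eq_zero hM h3

/-- A polynomial vanishing on the spectrum of `A` annihilates `A`. -/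
theorem aeval_eq_zero_of_isBigO {A : Matrix (Fin n) (Fin n) ℂ} {p : ℂ[X]}
    (h : ∀ a ∈ spectrum ℂ A, (fun z => p.eval z) =O[𝓝 a]
      fun z => (z - a) ^ (minpoly ℂ A).rootMultiplicity a) :
    aeval A p = 0 :=
  eq_zero_of_mul_aeval_cofactor fun a ha _ hM =>
    aeval_mul_aeval_cofactor_eq_zero hM (pow_dvd_of_isBigO (h a ha))

/-- Allows the uniform order `n + 1` in all interpolations; being nonzero even for `n = 0`, it also
forces equality of values. -/
lemma rootMultiplicity_minpoly_le (A : Matrix (Fin n) (Fin n) ℂ) (a : ℂ) :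
    (minpoly ℂ A).rootMultiplicity a ≤ n + 1 := by
  have h1 := rootMultiplicity_le_rootMultiplicity_of_dvd A.charpoly_monic.ne_zero
    A.minpoly_dvd_charpoly a
  have h2 : A.charpoly.rootMultiplicity a ≤ A.charpoly.natDegree := by
    rw [← count_roots]
    exact (Multiset.count_le_card _ _).trans (card_roots' _)
  rw [A.charpoly_natDegree_eq_dim, Fintype.card_fin] at h2
  omega

lemma spectrum_aeval (A : Matrix (Fin n) (Fin n) ℂ) (p : ℂ[X]) :
    spectrum ℂ (aeval A p) = (fun z => p.eval z) '' spectrum ℂ A := by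
  -- For `n = 0` the spectrum is empty, even for constant polynomials.
  cases n with
  | zero => simp [spectrum.of_subsingleton]
  | succ n =>
    exact spectrum.map_polynomial_aeval_of_nonempty A p
      (spectrum.nonempty_of_isAlgClosed_of_finiteDimensional ℂ A)

/-! ### The principal logarithm -/

/-- The exponential of `A` is a polynomial in `A`. -/
lemma exists_polynomial_exp (A : Matrix (Fin n) (Fin n) ℂ) :
    ∃ p : ℂ[X], NormedSpace.exp A = aeval A p ∧ ∀ a ∈ spectrum ℂ A,
      (fun z => p.eval z - Complex.exp z) =O[𝓝 a] fun z => (z - a) ^ (n + 1) := by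
  obtain ⟨p, hp⟩ := exists_polynomial_isBigO_sub A.finite_spectrum (f := Complex.exp)
    (fun a _ => Complex.differentiable_exp.analyticAt a) (n + 1)
  refine ⟨p, ?_, hp⟩
  have h := exp_aeval_eq_aeval (A := A) (q := X) (r := p) fun a ha => by
    simpa using (hp a ha).trans (isBigO_pow_of_le (rootMultiplicity_minpoly_le A a))
  simpa using h

lemma spectrum_exp (A : Matrix (Fin n) (Fin n) ℂ) :
    spectrum ℂ (NormedSpace.exp A) = Complex.exp '' spectrum ℂ A := by
  obtain ⟨p, hA, hp⟩ := exists_polynomial_exp A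
  rw [hA, spectrum_aeval]
  exact Set.image_congr fun a ha => eq_of_isBigO_sub n.succ_ne_zero (hp a ha)

lemma NoNonposEigenvalue.mem_slitPlane {A : Matrix (Fin n) (Fin n) ℂ}
    (hA : NoNonposEigenvalue A) {a : ℂ} (ha : a ∈ spectrum ℂ A) : a ∈ Complex.slitPlane := by
  rw [Complex.mem_slitPlane_iff]
  by_contra! h
  refine hA a.re h.1 ?_
  rwa [show (a.re : ℂ) = a from Complex.ext rfl (by simp [h.2])]

lemma SpectrumInStrip.noNonposEigenvalue_exp {X : Matrix (Fin n) (Fin n) ℂ}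
    (hX : SpectrumInStrip X) : NoNonposEigenvalue (NormedSpace.exp X) := by
  intro r hr hmem
  rw [spectrum_exp] at hmem
  obtain ⟨z, hz, hzr⟩ := hmem
  obtain ⟨h1, h2⟩ := hX z hz
  -- The value `0` is not attained by `exp`; a negative real has logarithm with imaginary part `π`,
  -- outside the open strip.
  have hr0 : r < 0 := hr.lt_of_ne fun h0 => Complex.exp_ne_zero z (by rw [hzr, h0]; simp)
  have h3 := Complex.log_exp h1 h2.le
  rw [hzr] at h3
  have h4 : z.im = Real.pi := by rw [← h3, Complex.log_im, Complex.arg_ofReal_of_neg hr0]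
  exact h2.ne h4

/-- The matrix logarithm as a polynomial: every polynomial that agrees with `log` to order
`n + 1` on the spectrum of `A` computes the unique principal logarithm of `A`. -/
lemma isPrincipalLog_iff_eq_aeval {A : Matrix (Fin n) (Fin n) ℂ} (hA : NoNonposEigenvalue A)
    {l : ℂ[X]} (hl : ∀ a ∈ spectrum ℂ A,
      (fun z => l.eval z - Complex.log z) =O[𝓝 a] fun z => (z - a) ^ (n + 1))
    (X : Matrix (Fin n) (Fin n) ℂ) : IsPrincipalLog A X ↔ X = aeval A l := by
  constructor
  · rintro ⟨hexp, hstrip⟩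
    obtain ⟨p, hp, hpO⟩ := exists_polynomial_exp X
    rw [hexp] at hp
    -- Since `A = p(X)` with `p` interpolating `exp`, the polynomial `l ∘ p` interpolates `log ∘
    -- exp`, which is the identity near each eigenvalue because the strip is open. Hence `l(A) = X`.
    have h : aeval X (l.comp p - Polynomial.X) = 0 := by
      refine aeval_eq_zero_of_isBigO fun x hx => ?_
      have hpx := eq_of_isBigO_sub n.succ_ne_zero (hpO x hx)
      have hxA : Complex.exp x ∈ spectrum ℂ A := by
        rw [← hexp, spectrum_exp]
        exact ⟨x, hx, rfl⟩
      have hexp_tendsto : Tendsto Complex.exp (𝓝 x) (𝓝 (Complex.exp x)) :=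
        Complex.continuous_exp.continuousAt
      have h1 : (fun z => l.eval (p.eval z) - l.eval (Complex.exp z)) =O[𝓝 x]
          fun z => (z - x) ^ (n + 1) :=
        (isBigO_comp_sub_comp (u := fun z => p.eval z) (analyticAt_eval l (Complex.exp x))
          (hpx ▸ p.continuous.continuousAt.tendsto) hexp_tendsto).trans (hpO x hx)
      have h2 : (fun z => l.eval (Complex.exp z) - Complex.log (Complex.exp z)) =O[𝓝 x]
          fun z => (z - x) ^ (n + 1) :=
        ((hl _ hxA).comp_tendsto hexp_tendsto).trans
          ((Complex.hasDerivAt_exp x).isBigO_sub.pow (n + 1))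
      refine IsBigO.trans ?_ (isBigO_pow_of_le (rootMultiplicity_minpoly_le X x))
      refine (h1.add h2).congr' ?_ EventuallyEq.rfl
      have him := Complex.continuous_im.continuousAt (x := x)
      filter_upwards [him.eventually_const_lt (hstrip x hx).1,
        him.eventually_lt_const (hstrip x hx).2] with z hz1 hz2
      simp [Complex.log_exp hz1 hz2.le]
    rw [map_sub, aeval_X, aeval_comp, ← hp, sub_eq_zero] at h
    exact h.symm
  · rintro rfl
    constructor
    · conv_rhs => rw [← aeval_X (R := ℂ) A]
      refine exp_aeval_eq_aeval fun a ha => ?_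
      have hla := eq_of_isBigO_sub n.succ_ne_zero (hl a ha)
      have has := hA.mem_slitPlane ha
      have h1 : (fun z => Complex.exp (Complex.log z) - Complex.exp (l.eval z)) =O[𝓝 a]
          fun z => Complex.log z - l.eval z :=
        isBigO_comp_sub_comp (v := fun z => l.eval z)
          (Complex.differentiable_exp.analyticAt (Complex.log a))
          (continuousAt_clog has) (hla ▸ l.continuous.continuousAt.tendsto)
      have h2 := h1.trans (((hl a ha).trans
        (isBigO_pow_of_le (rootMultiplicity_minpoly_le A a))).neg_left.congr_left (by simp))
      refine h2.congr' ?_ EventuallyEq.rfl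
      filter_upwards [isOpen_ne.mem_nhds (Complex.slitPlane_ne_zero has)] with z hz
      simp [Complex.exp_log hz]
    · intro z hz
      rw [spectrum_aeval] at hz
      obtain ⟨a, ha, rfl⟩ := hz
      have h1 := eq_of_isBigO_sub n.succ_ne_zero (hl a ha)
      simp only [h1, Complex.log_im]
      exact ⟨Complex.neg_pi_lt_arg a, (Complex.arg_le_pi a).lt_of_ne
        (Complex.mem_slitPlane_iff_arg.1 (hA.mem_slitPlane ha)).1⟩

lemma exists_log_polynomial {A : Matrix (Fin n) (Fin n) ℂ} (hA : NoNonposEigenvalue A) :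
    ∃ l : ℂ[X], ∀ a ∈ spectrum ℂ A,
      (fun z => l.eval z - Complex.log z) =O[𝓝 a] fun z => (z - a) ^ (n + 1) :=
  exists_polynomial_isBigO_sub A.finite_spectrum
    (fun _ ha => analyticAt_clog (hA.mem_slitPlane ha)) (n + 1)

theorem existsUnique_isPrincipalLog {A : Matrix (Fin n) (Fin n) ℂ} (hA : NoNonposEigenvalue A) :
    ∃! X, IsPrincipalLog A X := by
  obtain ⟨l, hl⟩ := exists_log_polynomial hA
  exact ⟨aeval A l, (isPrincipalLog_iff_eq_aeval hA hl _).2 rfl,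
    fun X hX => (isPrincipalLog_iff_eq_aeval hA hl X).1 hX⟩

lemma isPrincipalLog_principalLog {A : Matrix (Fin n) (Fin n) ℂ} (hA : NoNonposEigenvalue A) :
    IsPrincipalLog A (principalLog A) := by
  have h := (existsUnique_isPrincipalLog hA).exists
  rw [principalLog, dif_pos h]
  exact h.choose_spec

lemma principalLog_eq {A X : Matrix (Fin n) (Fin n) ℂ} (hX : IsPrincipalLog A X) :
    principalLog A = X := by
  have hA : NoNonposEigenvalue A := hX.1 ▸ hX.2.noNonposEigenvalue_exp
  exact (existsUnique_isPrincipalLog hA).unique (isPrincipalLog_principalLog hA) hX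

lemma principalLog_exp {X : Matrix (Fin n) (Fin n) ℂ} (hX : SpectrumInStrip X) :
    principalLog (NormedSpace.exp X) = X :=
  principalLog_eq ⟨rfl, hX⟩

/-! ### Real powers and the principal square root -/

lemma spectrum_smul (c : ℂ) (A : Matrix (Fin n) (Fin n) ℂ) :
    spectrum ℂ (c • A) = (fun z => c * z) '' spectrum ℂ A := by
  have h := spectrum_aeval A (C c * X)
  simp only [map_mul, aeval_C, aeval_X, eval_mul, eval_C, eval_X] at h
  rwa [Algebra.smul_def]

/-- A polynomial interpolates `f` on the spectrum of `A` iff it agrees with `f` to the order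
given by the minimal polynomial. -/
lemma interpolates_iff_isBigO {f : ℂ → ℂ} {A : Matrix (Fin n) (Fin n) ℂ}
    (hf : ∀ a ∈ spectrum ℂ A, AnalyticAt ℂ f a) (p : ℂ[X]) :
    Interpolates f A p ↔ ∀ a ∈ spectrum ℂ A, (fun z => p.eval z - f z) =O[𝓝 a]
      fun z => (z - a) ^ (minpoly ℂ A).rootMultiplicity a := by
  refine forall₂_congr fun a ha => ?_
  rw [isBigO_pow_iff_iteratedDeriv_eq_zero ((analyticAt_eval p a).fun_sub (hf a ha))]
  refine forall₂_congr fun k _ => ?_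
  rw [iteratedDeriv_fun_sub (analyticAt_eval p a).contDiffAt (hf a ha).contDiffAt,
    eval_iterate_derivative_eq_iteratedDeriv, sub_eq_zero]

theorem exp_smul_principalLog {A : Matrix (Fin n) (Fin n) ℂ} (hA : NoNonposEigenvalue A)
    (α : ℝ) : NormedSpace.exp ((α : ℂ) • principalLog A) = realPow A α := by
  obtain ⟨l, hl⟩ := exists_log_polynomial hA
  have hlog := (isPrincipalLog_iff_eq_aeval hA hl _).1 (isPrincipalLog_principalLog hA)
  have han : ∀ a ∈ spectrum ℂ A, AnalyticAt ℂ (fun z : ℂ => z ^ (α : ℂ)) a := fun a ha =>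
    analyticAt_id.cpow analyticAt_const (hA.mem_slitPlane ha)
  have hex : ∃ p : ℂ[X], Interpolates (fun z : ℂ => z ^ (α : ℂ)) A p := by
    obtain ⟨p, hp⟩ := exists_polynomial_isBigO_sub A.finite_spectrum han (n + 1)
    exact ⟨p, (interpolates_iff_isBigO han p).2 fun a ha =>
      (hp a ha).trans (isBigO_pow_of_le (rootMultiplicity_minpoly_le A a))⟩
  rw [realPow, primaryFunction, dif_pos hex]
  -- The chosen interpolant is arbitrary; only its interpolation property is used.
  have hp := (interpolates_iff_isBigO han _).1 hex.choose_spec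
  rw [hlog, ← map_smul]
  refine exp_aeval_eq_aeval fun a ha => ?_
  have hla := eq_of_isBigO_sub n.succ_ne_zero (hl a ha)
  have has := hA.mem_slitPlane ha
  have h1 : (fun z => Complex.exp (α * Complex.log z) - Complex.exp (α * l.eval z)) =O[𝓝 a]
      fun z => Complex.log z - l.eval z :=
    isBigO_comp_sub_comp (F := fun w => Complex.exp (α * w)) (v := fun z => l.eval z)
      (b := Complex.log a)
      ((Complex.differentiable_exp.comp (differentiable_id.const_mul (α : ℂ))).analyticAt _)
      (continuousAt_clog has) (hla ▸ l.continuous.continuousAt.tendsto)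
  have h2 : (fun z => Complex.exp (α * Complex.log z) - Complex.exp (α * l.eval z)) =O[𝓝 a]
      fun z => (z - a) ^ (minpoly ℂ A).rootMultiplicity a :=
    h1.trans (((hl a ha).trans
      (isBigO_pow_of_le (rootMultiplicity_minpoly_le A a))).neg_left.congr_left (by simp))
  refine ((hp a ha).add h2).congr' ?_ EventuallyEq.rfl
  filter_upwards [isOpen_ne.mem_nhds (Complex.slitPlane_ne_zero has)] with z hz
  simp [Complex.cpow_def_of_ne_zero hz, mul_comm]

/-- Doubling the logarithm of a principal square root yields a logarithm of `A` still in the strip,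
so uniqueness applies. -/
theorem isPrincipalSqrt_iff {A : Matrix (Fin n) (Fin n) ℂ} (hA : NoNonposEigenvalue A)
    (X : Matrix (Fin n) (Fin n) ℂ) :
    IsPrincipalSqrt A X ↔ X = NormedSpace.exp ((1 / 2 : ℂ) • principalLog A) := by
  constructor
  · rintro ⟨hXA, hre⟩
    have hX : NoNonposEigenvalue X := fun r hr hmem => by
      have := hre _ hmem
      rw [Complex.ofReal_re] at this
      linarith
    obtain ⟨hexp, hstrip⟩ := isPrincipalLog_principalLog hX
    have hlog : IsPrincipalLog A ((2 : ℂ) • principalLog X) := by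
      constructor
      · rw [two_smul, Matrix.exp_add_of_commute _ _ (Commute.refl _), hexp, hXA]
      · intro z hz
        rw [spectrum_smul] at hz
        obtain ⟨y, hy, rfl⟩ := hz
        have h1 : 0 < (Complex.exp y).re := hre _ (by
          rw [← hexp, spectrum_exp]
          exact ⟨y, hy, rfl⟩)
        rw [Complex.exp_re] at h1
        have h2 := pos_of_mul_pos_right h1 (Real.exp_pos _).le
        -- A positive real part of `exp y` means `cos (Im y) > 0`, which within the strip forces
        -- `|Im y| < π / 2`.
        have h3 : |y.im| < Real.pi / 2 := by
          by_contra! h4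
          rw [← Real.cos_abs] at h2
          refine absurd h2 (not_lt.2 (Real.cos_nonpos_of_pi_div_two_le_of_le h4 ?_))
          have := abs_lt.2 (hstrip y hy)
          linarith [Real.pi_pos]
        rw [abs_lt] at h3
        simp only [Complex.mul_im, Complex.re_ofNat, Complex.im_ofNat, zero_mul, add_zero]
        constructor <;> linarith
    rw [principalLog_eq hlog, smul_smul]
    norm_num [hexp]
  · rintro rfl
    obtain ⟨hexp, hstrip⟩ := isPrincipalLog_principalLog hA
    constructor
    · rw [← Matrix.exp_add_of_commute _ _ (Commute.refl _), ← add_smul]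
      norm_num [hexp]
    · intro z hz
      rw [spectrum_exp, spectrum_smul] at hz
      obtain ⟨_, ⟨y, hy, rfl⟩, rfl⟩ := hz
      rw [Complex.exp_re]
      have h1 : ((1 / 2 : ℂ) * y).im = y.im / 2 := by
        rw [show (1 / 2 : ℂ) = ((1 / 2 : ℝ) : ℂ) by norm_num, Complex.im_ofReal_mul]
        ring
      obtain ⟨h2, h3⟩ := hstrip y hy
      refine mul_pos (Real.exp_pos _) (Real.cos_pos_of_mem_Ioo ⟨?_, ?_⟩) <;> rw [h1] <;> linarith

/-! ### Invertibility, the identity, adjoints and similarity -/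

lemma NoNonposEigenvalue.isUnit {A : Matrix (Fin n) (Fin n) ℂ} (hA : NoNonposEigenvalue A) :
    IsUnit A :=
  spectrum.isUnit_of_zero_notMem ℂ (by simpa using hA 0 le_rfl)

lemma spectrumInStrip_zero : SpectrumInStrip (0 : Matrix (Fin n) (Fin n) ℂ) := by
  intro z hz
  -- Writing the zero matrix as `0 • 0` covers the empty spectrum at `n = 0` too.
  have h := spectrum_smul 0 (0 : Matrix (Fin n) (Fin n) ℂ)
  rw [smul_zero] at h
  rw [h] at hz
  obtain ⟨y, -, rfl⟩ := hz
  simp [Real.pi_pos]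

lemma noNonposEigenvalue_one : NoNonposEigenvalue (1 : Matrix (Fin n) (Fin n) ℂ) := by
  simpa using (spectrumInStrip_zero (n := n)).noNonposEigenvalue_exp

lemma spectrum_conjTranspose (A : Matrix (Fin n) (Fin n) ℂ) :
    spectrum ℂ A.conjTranspose = star (spectrum ℂ A) :=
  spectrum.map_star A

lemma NoNonposEigenvalue.conjTranspose {A : Matrix (Fin n) (Fin n) ℂ}
    (hA : NoNonposEigenvalue A) : NoNonposEigenvalue A.conjTranspose := by
  intro r hr hmem
  rw [spectrum_conjTranspose, Set.mem_star] at hmem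
  exact hA r hr (by simpa using hmem)

lemma principalLog_conjTranspose {A : Matrix (Fin n) (Fin n) ℂ} (hA : NoNonposEigenvalue A) :
    principalLog A.conjTranspose = (principalLog A).conjTranspose := by
  obtain ⟨hexp, hstrip⟩ := isPrincipalLog_principalLog hA
  refine principalLog_eq ⟨by rw [Matrix.exp_conjTranspose, hexp], fun z hz => ?_⟩
  rw [spectrum_conjTranspose, Set.mem_star] at hz
  have h := hstrip _ hz
  simp only [Complex.star_def, Complex.conj_im] at h
  constructor <;> linarith

lemma spectrum_conj {S : Matrix (Fin n) (Fin n) ℂ} (hS : IsUnit S)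
    (A : Matrix (Fin n) (Fin n) ℂ) : spectrum ℂ (S * A * S⁻¹) = spectrum ℂ A := by
  obtain ⟨u, rfl⟩ := hS
  rw [← Matrix.coe_units_inv]
  exact spectrum.units_conjugate

lemma NoNonposEigenvalue.conj {A S : Matrix (Fin n) (Fin n) ℂ} (hA : NoNonposEigenvalue A)
    (hS : IsUnit S) : NoNonposEigenvalue (S * A * S⁻¹) := by
  rw [NoNonposEigenvalue, spectrum_conj hS]
  exact hA

lemma principalLog_conj {A S : Matrix (Fin n) (Fin n) ℂ} (hA : NoNonposEigenvalue A)
    (hS : IsUnit S) : principalLog (S * A * S⁻¹) = S * principalLog A * S⁻¹ := by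
  obtain ⟨hexp, hstrip⟩ := isPrincipalLog_principalLog hA
  refine principalLog_eq ⟨by rw [Matrix.exp_conj _ _ hS, hexp], ?_⟩
  rw [SpectrumInStrip, spectrum_conj hS]
  exact hstrip

lemma exp_neg_mul_exp (X : Matrix (Fin n) (Fin n) ℂ) :
    NormedSpace.exp (-X) * NormedSpace.exp X = 1 := by
  rw [← Matrix.exp_add_of_commute _ _ (Commute.refl X).neg_left, neg_add_cancel,
    NormedSpace.exp_zero]

lemma exp_mul_exp_neg (X : Matrix (Fin n) (Fin n) ℂ) :
    NormedSpace.exp X * NormedSpace.exp (-X) = 1 := by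
  simpa using exp_neg_mul_exp (-X)

end MatrixPower

end

/-! ### The rules for matrix powers -/

theorem lemma2p1 (n : ℕ) (A B : Matrix (Fin n) (Fin n) ℂ)
    (hA : MatrixPower.NoNonposEigenvalue A) :
    -- the principal logarithm of `A` is well defined
    (∃! X, MatrixPower.IsPrincipalLog A X) ∧
    -- (i)
    (MatrixPower.matPow A 0 = 1 ∧
      MatrixPower.NoNonposEigenvalue (1 : Matrix (Fin n) (Fin n) ℂ) ∧
      MatrixPower.matPow 1 B = 1) ∧
    -- (ii)
    ((∀ α : ℝ,
        MatrixPower.matPow A ((α : ℂ) • (1 : Matrix (Fin n) (Fin n) ℂ)) =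
          MatrixPower.realPow A α) ∧
      (∀ X : Matrix (Fin n) (Fin n) ℂ, MatrixPower.IsPrincipalSqrt A X ↔
        X = MatrixPower.matPow A ((1 / 2 : ℂ) • (1 : Matrix (Fin n) (Fin n) ℂ))) ∧
      (IsUnit A ∧ MatrixPower.matPow A (-1) = A⁻¹)) ∧
    -- (iii)
    (MatrixPower.SpectrumInStrip (MatrixPower.principalLog A * B) →
      MatrixPower.NoNonposEigenvalue (MatrixPower.matPow A B) ∧
      ∀ C : Matrix (Fin n) (Fin n) ℂ,
        MatrixPower.matPow A (B * C) = MatrixPower.matPow (MatrixPower.matPow A B) C) ∧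
    -- (iv)
    (MatrixPower.matPow A (-B) * MatrixPower.matPow A B = 1 ∧
      MatrixPower.matPow A B * MatrixPower.matPow A (-B) = 1 ∧
      (MatrixPower.matPow A B)⁻¹ = MatrixPower.matPow A (-B)) ∧
    -- (v)
    (MatrixPower.NoNonposEigenvalue A.conjTranspose ∧
      (MatrixPower.matPow A B).conjTranspose =
        MatrixPower.leftMatPow A.conjTranspose B.conjTranspose) ∧
    -- (vi)
    (∀ S : Matrix (Fin n) (Fin n) ℂ, IsUnit S →
      MatrixPower.NoNonposEigenvalue (S * A * S⁻¹) ∧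
      MatrixPower.matPow (S * A * S⁻¹) (S * B * S⁻¹) =
        S * MatrixPower.matPow A B * S⁻¹) := by
  open MatrixPower in
  obtain ⟨hexp, hstrip⟩ := isPrincipalLog_principalLog hA
  refine ⟨existsUnique_isPrincipalLog hA, ⟨?_, noNonposEigenvalue_one, ?_⟩,
    ⟨fun α => ?_, fun X => ?_, hA.isUnit, ?_⟩, fun hAB => ⟨hAB.noNonposEigenvalue_exp, fun C => ?_⟩,
    ⟨?_, ?_, ?_⟩, ⟨hA.conjTranspose, ?_⟩, fun S hS => ⟨hA.conj hS, ?_⟩⟩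
  · rw [matPow, mul_zero, NormedSpace.exp_zero]
  · have h : principalLog (1 : Matrix (Fin n) (Fin n) ℂ) = 0 := by
      rw [← NormedSpace.exp_zero, principalLog_exp spectrumInStrip_zero]
    rw [matPow, h, zero_mul, NormedSpace.exp_zero]
  · rw [matPow, mul_smul_comm, mul_one, exp_smul_principalLog hA]
  · rw [matPow, mul_smul_comm, mul_one, isPrincipalSqrt_iff hA]
  · rw [matPow, mul_neg, mul_one, Matrix.exp_neg, hexp]
  -- The strip condition makes `log(A) B` the logarithm of `A ^ B`; the rest is associativity.
  · rw [matPow, matPow, matPow, principalLog_exp hAB, mul_assoc]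
  · rw [matPow, matPow, mul_neg, exp_neg_mul_exp]
  · rw [matPow, matPow, mul_neg, exp_mul_exp_neg]
  · rw [matPow, matPow, mul_neg, Matrix.exp_neg]
  -- The adjoint reverses the product in the exponent, hence the left power.
  · rw [matPow, leftMatPow, principalLog_conjTranspose hA, ← Matrix.conjTranspose_mul,
      Matrix.exp_conjTranspose]
  · have h : S⁻¹ * S = 1 := Matrix.nonsing_inv_mul _ ((Matrix.isUnit_iff_isUnit_det S).1 hS)
    rw [matPow, matPow, principalLog_conj hA hS, ← Matrix.exp_conj _ _ hS]
    congr 1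
    calc S * principalLog A * S⁻¹ * (S * B * S⁻¹)
        = S * principalLog A * (S⁻¹ * S) * B * S⁻¹ := by noncomm_ring
      _ = S * (principalLog A * B) * S⁻¹ := by rw [h]; noncomm_ring
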